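/- A probabilistic weighted automaton $A=\langle Q,\rho_I,\Sigma,\delta,\gamma\rangle$ consists of a finite set $Q$ of states, an initial probability distribution $\rho_I$ on $Q$, a finite alphabet $\Sigma$, a probabilistic transition function $\delta$ assigning to every $(q,\sigma)\in Q\times\Sigma$ a probability distribution $\delta(q,\sigma)$ on $Q$, and a weight function $\gamma:Q\times\Sigma\times Q\to\mathbb{Q}$. A run of $A$ over an infinite word $w=\sigma_1\sigma_2\dots\in\Sigma^\omega$ is a state sequence $r=q_0q_1q_2\dots$ with $\rho_I(q_0)>0$ and $\delta(q_i,\sigma_{i+1})(q_{i+1})>0$ for all $i\ge 0$. Let $\mathbb{P}^A_w$ be the unique Borel probability measure on infinite state sequences for which, for all $k$, the sequences starting with $q_0,\dots,q_k$ have probability $\rho_I(q_0)\prod_{i=1}^{k}\delta(q_{i-1},\sigma_i)(q_i)$. For a discount factor $\lambda\in(0,1)$, the discounted sum of $r$ is $\mathsf{Disc}_\lambda(r)=\sum_{i\ge0}\lambda^i\,\gamma(q_i,\sigma_{i+1},q_{i+1})$. The value of $w$ is $$L^{>0}_A(w)=\sup\{\eta\in\mathbb{R}\mid \mathbb{P}^A_w(\{r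 \text{ a run over } w\mid \mathsf{Disc}_\lambda(r)\ge\eta\})>0\}$$ under the positive semantics (PosDisc), and $$L^{=1}_A(w)=\sup\{\eta\in\mathbb{R}\mid \mathbb{P}^A_w(\{r \text{ a run over } w\mid \mathsf{Disc}_\lambda(r)\ge\eta\})=1\}$$ under the almost-sure semantics (AsDisc). Theorem. The following two decision problems are decidable. In both, the input is a probabilistic weighted automaton $A$ with rational transition and initial probabilities, a rational discount factor $\lambda$ with $0<\lambda<1$, and a threshold $\nu\in\mathbb{Q}$ (all rational numbers being given by reduced numerator and denominator). 1. (Quantitative emptiness for PosDisc) Does there exist a word $w\in\Sigma^\omega$ with $L^{>0}_A(w)\ge\nu$? 2. (Quantitative universality for AsDisc) Does $L^{=1}_A(w)\ge\nu$ hold for all words $w\in\Sigma^\omega$? -/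

import Mathlib

open MeasureTheory ProbabilityTheory

/-! ### Probabilistic weighted automata -/

/-- A probabilistic weighted automaton with finite set of states `Q` and alphabet `S`: an initial
distribution on `Q`, a probabilistic transition function `Q × S → 𝒟(Q)` and a rational weight
function on `Q × S × Q`. Here `stdSimplex ℝ Q` is the set of probability distributions on `Q`. -/
structure ProbWeightedAutomaton (Q S : Type*) [Fintype Q] where
  init : Q → ℝ
  init_mem : init ∈ stdSimplex ℝ Q
  trans : Q → S → Q → ℝ
  trans_mem : ∀ q a, trans q a ∈ stdSimplex ℝ Q
  weight : Q → S → Q → ℚ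

/-- The probability mass function given by a probability vector on a finite set. -/
noncomputable def pmfOfSimplex {Q : Type*} [Fintype Q] (f : Q → ℝ) (hf : f ∈ stdSimplex ℝ Q) :
    PMF Q :=
  PMF.ofFintype (fun q => ENNReal.ofReal (f q)) (by
    rw [← ENNReal.ofReal_sum_of_nonneg (fun q _ => hf.1 q), hf.2, ENNReal.ofReal_one])

namespace ProbWeightedAutomaton

variable {Q S : Type*} [Fintype Q]

/-- The state sequence `r 0, r 1, …` is a run over the infinite word `w 0, w 1, …`. -/
def IsRun (A : ProbWeightedAutomaton Q S) (w : ℕ → S) (r : ℕ → Q) : Prop :=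
  0 < A.init (r 0) ∧ ∀ i, 0 < A.trans (r i) (w i) (r (i + 1))

/-- The sequence of weights that occur in the run `r` over the word `w`. -/
def weights (A : ProbWeightedAutomaton Q S) (w : ℕ → S) (r : ℕ → Q) (i : ℕ) : ℚ :=
  A.weight (r i) (w i) (r (i + 1))

section Semantics

variable [MeasurableSpace Q] [DiscreteMeasurableSpace Q]

/-- The Markov kernel `q ↦ δ(q, a)`. -/
noncomputable def letterKernel (A : ProbWeightedAutomaton Q S) (a : S) : Kernel Q Q :=
  Kernel.ofFunOfCountable fun q => (pmfOfSimplex (A.trans q a) (A.trans_mem q a)).toMeasure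

instance (A : ProbWeightedAutomaton Q S) (a : S) : IsMarkovKernel (A.letterKernel a) where
  isProbabilityMeasure q := by
    change IsProbabilityMeasure (pmfOfSimplex (A.trans q a) (A.trans_mem q a)).toMeasure
    infer_instance

/-- The kernel that maps a history `q₀, …, qₙ` to the distribution `δ(qₙ, wₙ)` of the next state. -/
noncomputable def stepKernel (A : ProbWeightedAutomaton Q S) (w : ℕ → S) (n : ℕ) :
    Kernel (Finset.Iic n → Q) Q :=
  (A.letterKernel (w n)).comap (fun h => h ⟨n, Finset.mem_Iic.2 le_rfl⟩) (measurable_pi_apply _)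

instance (A : ProbWeightedAutomaton Q S) (w : ℕ → S) (n : ℕ) :
    IsMarkovKernel (A.stepKernel w n) := by
  unfold stepKernel; infer_instance

/-- The probability measure `ℙ^A` on infinite state sequences, for the input word `w`. -/
noncomputable def runMeasure (A : ProbWeightedAutomaton Q S) (w : ℕ → S) : Measure (ℕ → Q) :=
  Kernel.trajMeasure (X := fun _ => Q) (pmfOfSimplex A.init A.init_mem).toMeasure (A.stepKernel w)

/-- The measure `ℙ^A` gives each finite run its probability; this determines it uniquely. -/
theorem runMeasure_cylinder (A : ProbWeightedAutomaton Q S) (w : ℕ → S) (s : ℕ → Q) (k : ℕ) :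
    A.runMeasure w {r | ∀ i ≤ k, r i = s i} =
      ENNReal.ofReal (A.init (s 0) * ∏ i ∈ Finset.range k, A.trans (s i) (w i) (s (i + 1))) := by
  classical
  induction k with
  | zero =>
    have h : (A.runMeasure w).map (Preorder.frestrictLe 0) =
      ((pmfOfSimplex A.init A.init_mem).toMeasure).map (MeasurableEquiv.piUnique (fun _ : Finset.Iic 0 => Q)).symm := by
      rw [runMeasure, Kernel.trajMeasure, Measure.map_comp _ _ (by fun_prop),
        Kernel.traj_map_frestrictLe, Kernel.partialTraj_self, Measure.id_comp]
    have h2 : (A.runMeasure w).map (fun r => r 0) = (pmfOfSimplex A.init A.init_mem).toMeasure := by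
      have : (fun r : ℕ → Q => r 0) = (fun g : Finset.Iic 0 → Q => g ⟨0, by simp⟩) ∘ Preorder.frestrictLe 0 := rfl
      rw [this, ← Measure.map_map (by fun_prop) (by fun_prop), h, Measure.map_map (by fun_prop) (by fun_prop)]
      have e : (fun g : Finset.Iic 0 → Q => g ⟨0, by simp⟩) ∘ (MeasurableEquiv.piUnique (fun _ : Finset.Iic 0 => Q)).symm = id := by
        funext q
        exact (MeasurableEquiv.piUnique (fun _ : Finset.Iic 0 => Q)).apply_symm_apply q
      rw [e, Measure.map_id]
    have : {r : ℕ → Q | ∀ i ≤ 0, r i = s i} = (fun r => r 0) ⁻¹' {s 0} := by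
      ext r; simp
    rw [this, ← Measure.map_apply (by fun_prop) (measurableSet_singleton _), h2,
      PMF.toMeasure_apply_singleton _ _ (measurableSet_singleton _)]
    simp [pmfOfSimplex]
  | succ k ih =>
    have h := @Kernel.map_frestrictLe_trajMeasure_compProd_eq_map_trajMeasure (fun _ => Q) _
      (A.stepKernel w) _ (pmfOfSimplex A.init A.init_mem).toMeasure _ k
    change (A.runMeasure w).map _ ⊗ₘ _ = (A.runMeasure w).map _ at h
    let c : Finset.Iic k → Q := fun i => s i
    have h1 : {r : ℕ → Q | ∀ i ≤ k + 1, r i = s i} =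
        (fun x : ℕ → Q => (Preorder.frestrictLe k x, x (k+1))) ⁻¹' ({c} ×ˢ {s (k+1)}) := by
      ext r
      simp only [Set.mem_ofPred_eq, Set.mem_preimage, Set.mem_prod, Set.mem_singleton_iff, c, funext_iff]
      constructor
      · intro h
        exact ⟨fun i => h i (by have := Finset.mem_Iic.1 i.2; omega), h _ le_rfl⟩
      · rintro ⟨h, h'⟩ i hi
        rcases Nat.lt_or_ge k i with h2 | h2
        · obtain rfl : i = k + 1 := by omega
          exact h'
        · exact h ⟨i, by simpa using h2⟩
    have h3 : {r : ℕ → Q | ∀ i ≤ k, r i = s i} = (Preorder.frestrictLe (π := fun _ => Q) k) ⁻¹' {c} := by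
      ext r
      simp only [Set.mem_ofPred_eq, Set.mem_preimage, Set.mem_singleton_iff, c, funext_iff]
      exact ⟨fun h i => h i (Finset.mem_Iic.1 i.2), fun h i hi => h ⟨i, by simpa using hi⟩⟩
    rw [h1, ← Measure.map_apply (by fun_prop) (by measurability), ← h,
      Measure.compProd_apply_prod (by measurability) (by measurability),
      lintegral_singleton, Measure.map_apply (by fun_prop) (by measurability), ← h3, ih]
    have hp : 0 ≤ A.init (s 0) * ∏ i ∈ Finset.range k, A.trans (s i) (w i) (s (i + 1)) :=
      mul_nonneg (A.init_mem.1 _) (Finset.prod_nonneg fun i _ => (A.trans_mem _ _).1 _)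
    have hk : (A.stepKernel w k c) {s (k + 1)} = ENNReal.ofReal (A.trans (s k) (w k) (s (k + 1))) := by
      rw [stepKernel, Kernel.comap_apply]
      change (pmfOfSimplex (A.trans (s k) (w k)) _).toMeasure _ = _
      rw [PMF.toMeasure_apply_singleton _ _ (measurableSet_singleton _)]
      rfl
    rw [hk, Finset.prod_range_succ, ← mul_assoc, ENNReal.ofReal_mul hp, mul_comm]

/-- The value of the word `w` under the positive semantics, for the value function `Val`. -/
noncomputable def posValue (A : ProbWeightedAutomaton Q S) (Val : (ℕ → ℚ) → ℝ) (w : ℕ → S) : ℝ :=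
  sSup {η : ℝ | 0 < A.runMeasure w {r | A.IsRun w r ∧ η ≤ Val (A.weights w r)}}

/-- The value of the word `w` under the almost-sure semantics, for the value function `Val`. -/
noncomputable def asValue (A : ProbWeightedAutomaton Q S) (Val : (ℕ → ℚ) → ℝ) (w : ℕ → S) : ℝ :=
  sSup {η : ℝ | A.runMeasure w {r | A.IsRun w r ∧ η ≤ Val (A.weights w r)} = 1}

end Semantics

end ProbWeightedAutomaton

/-- The discounted sum `∑ᵢ cⁱ vᵢ` with discount factor `c`. -/
noncomputable def discSum (c : ℝ) (v : ℕ → ℚ) : ℝ := ∑' i, c ^ i * (v i : ℝ)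

/-! ### Instances of the decision problems and their encoding -/

/-- An instance of the quantitative decision problems for discounted-sum automata: a probabilistic
weighted automaton with states `Fin numStates`, letters `Fin numLetters` and rational
probabilities, a rational discount factor in `(0, 1)`, and a rational threshold. -/
structure DiscInstance where
  numStates : ℕ
  numLetters : ℕ
  init : Fin numStates → ℚ
  init_mem : init ∈ stdSimplex ℚ (Fin numStates)
  trans : Fin numStates → Fin numLetters → Fin numStates → ℚ
  trans_mem : ∀ q a, trans q a ∈ stdSimplex ℚ (Fin numStates)
  weight : Fin numStates → Fin numLetters → Fin numStates → ℚ
  discount : ℚ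
  discount_pos : 0 < discount
  discount_lt_one : discount < 1
  threshold : ℚ

theorem cast_mem_stdSimplex {Q : Type*} [Fintype Q] {f : Q → ℚ} (hf : f ∈ stdSimplex ℚ Q) :
    (fun q => (f q : ℝ)) ∈ stdSimplex ℝ Q :=
  ⟨fun q => Rat.cast_nonneg.2 (hf.1 q), by simpa using congrArg (Rat.cast : ℚ → ℝ) hf.2⟩

/-- A rational number is written as its reduced numerator and denominator. -/
def ratCode (x : ℚ) : ℤ × ℕ := (x.num, x.den)

theorem ratCode_injective : Function.Injective ratCode := fun _ _ h =>
  Rat.ext (congrArg Prod.fst h) (congrArg Prod.snd h)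

/-- Input strings: number of states, number of letters, initial distribution, transition
probabilities and weights (as nested lists), discount factor, threshold. -/
abbrev DiscCode : Type :=
  (ℕ × ℕ) × (List (ℤ × ℕ) × List (List (List (ℤ × ℕ))) × List (List (List (ℤ × ℕ)))) ×
    ((ℤ × ℕ) × (ℤ × ℕ))

/-- The table of a rational function on `Q × S × Q` as a nested list. -/
def tableCode {n m : ℕ} (t : Fin n → Fin m → Fin n → ℚ) : List (List (List (ℤ × ℕ))) :=
  List.ofFn fun q => List.ofFn fun a => List.ofFn fun q' => ratCode (t q a q')

theorem tableCode_injective {n m : ℕ} :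
    Function.Injective (tableCode : (Fin n → Fin m → Fin n → ℚ) → _) := by
  intro t t' h
  funext q a q'
  have h1 := congrFun (List.ofFn_injective h) q
  have h2 := congrFun (List.ofFn_injective h1) a
  have h3 := congrFun (List.ofFn_injective h2) q'
  exact ratCode_injective h3

namespace DiscInstance

/-- The probabilistic weighted automaton of an instance. -/
def automaton (x : DiscInstance) :
    ProbWeightedAutomaton (Fin x.numStates) (Fin x.numLetters) where
  init q := (x.init q : ℝ)
  init_mem := cast_mem_stdSimplex x.init_mem
  trans q a q' := (x.trans q a q' : ℝ)
  trans_mem q a := cast_mem_stdSimplex (x.trans_mem q a)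
  weight := x.weight

/-- The finite description of an instance that is given to an algorithm. -/
def encode (x : DiscInstance) : DiscCode :=
  ((x.numStates, x.numLetters),
    (List.ofFn fun q => ratCode (x.init q), tableCode x.trans, tableCode x.weight),
    (ratCode x.discount, ratCode x.threshold))

theorem encode_injective : Function.Injective encode := by
  rintro ⟨n, m, i, hi, t, ht, g, c, hc, hc', v⟩ ⟨n', m', i', hi', t', ht', g', d, hd, hd', v'⟩ h
  simp only [encode, Prod.mk.injEq] at h
  obtain ⟨⟨rfl, rfl⟩, ⟨h1, h2, h3⟩, h4, h5⟩ := h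
  obtain rfl : i = i' := by
    funext q
    exact ratCode_injective (congrFun (List.ofFn_injective h1) q)
  obtain rfl := tableCode_injective h2
  obtain rfl := tableCode_injective h3
  obtain rfl := ratCode_injective h4
  obtain rfl := ratCode_injective h5
  rfl

/-- Some infinite word has value at least the threshold under the positive semantics. -/
def PosNonempty (x : DiscInstance) : Prop :=
  ∃ w : ℕ → Fin x.numLetters, (x.threshold : ℝ) ≤ x.automaton.posValue (discSum x.discount) w

/-- All infinite words have value at least the threshold under the almost-sure semantics. -/
def AsUniversal (x : DiscInstance) : Prop :=
  ∀ w : ℕ → Fin x.numLetters, (x.threshold : ℝ) ≤ x.automaton.asValue (discSum x.discount) w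

/-- A decision problem on instances is decidable if the set of encodings of its positive instances
is a computable (recursive) set. -/
def DecidableProblem (P : DiscInstance → Prop) : Prop :=
  ComputablePred fun c : DiscCode => ∃ x : DiscInstance, x.encode = c ∧ P x

end DiscInstance

/-! ### Primitive recursive arithmetic -/

/-! Only the supports of the distributions matter. For a fixed word almost every state sequence is a
run, every finite prefix of a run has positive probability, and the discounted sum depends
continuously on the run. Hence the positive value of a word is the supremum of the discounted sums
of its runs (`isLUB_posValue`), and the almost-sure value is their infimum (`isGLB_asValue`).

Both questions, the second after negation, then ask for a word together with a run, so letter and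
successor are chosen jointly along a path in a finite weighted graph. The optimal discounted sums
solve a Bellman equation. It has a rational solution because an optimal choice can be made among
finitely many positional policies, each of whose values solves a rational linear system
(`exists_bellman_solution`). A potential satisfying one-sided Bellman inequalities bounds discounted
sums by telescoping, so such a solution yields a finite certificate for either the positive or the
negative answer.

The algorithm need not compute the solution: it enumerates lists of rationals until one passes the
check for a certificate or for a refutation (`computablePred_of_certificates`). The checks involve
only rational arithmetic and bounded quantifiers, which are shown to be primitive recursive. -/

theorem Primrec.int_toNat : Primrec Int.toNat := by
  -- The encoding of `ℤ` sends n ≥ 0 to 2n and -(n + 1) to 2n + 1, so sign and size are read off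
  -- from parity and half.
  have h : Primrec fun z : ℤ =>
      if Encodable.encode z % 2 = 0 then Encodable.encode z / 2 else 0 :=
    .ite (Primrec.eq.comp (Primrec.nat_mod.comp .encode (.const 2)) (.const 0))
      (Primrec.nat_div.comp .encode (.const 2)) (.const 0)
  refine h.of_eq fun z => ?_
  cases z with
  | ofNat n =>
    have : Encodable.encode (Int.ofNat n) = 2 * n := rfl
    rw [this]; simp
  | negSucc n =>
    have : Encodable.encode (Int.negSucc n) = 2 * n + 1 := rfl
    rw [this, if_neg (by omega)]; simp

theorem Primrec.int_neg_toNat : Primrec fun z : ℤ => (-z).toNat := by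
  have h : Primrec fun z : ℤ =>
      if Encodable.encode z % 2 = 0 then 0 else Encodable.encode z / 2 + 1 :=
    .ite (Primrec.eq.comp (Primrec.nat_mod.comp .encode (.const 2)) (.const 0)) (.const 0)
      (Primrec.succ.comp (Primrec.nat_div.comp .encode (.const 2)))
  refine h.of_eq fun z => ?_
  cases z with
  | ofNat n =>
    have : Encodable.encode (Int.ofNat n) = 2 * n := rfl
    rw [this]; simp
  | negSucc n =>
    have : Encodable.encode (Int.negSucc n) = 2 * n + 1 := rfl
    rw [this, if_neg (by omega)]; simp [Int.neg_negSucc]; omega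

theorem Primrec.nat_sub_int : Primrec₂ fun a b : ℕ => (a : ℤ) - b := by
  have h : Primrec₂ fun a b : ℕ => if b ≤ a then 2 * (a - b) else 2 * (b - a - 1) + 1 :=
    .ite (Primrec.nat_le.comp .snd .fst) (Primrec.nat_double.comp (Primrec.nat_sub.comp .fst .snd))
      (Primrec.nat_double_succ.comp
        (Primrec.nat_sub.comp (Primrec.nat_sub.comp .snd .fst) (.const 1)))
  refine Primrec₂.encode_iff.1 (h.of_eq fun a b => ?_)
  by_cases hab : b ≤ a
  · obtain ⟨k, rfl⟩ := Nat.exists_eq_add_of_le hab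
    rw [if_pos hab, show ((b + k : ℕ) : ℤ) - b = Int.ofNat k by push_cast; simp]
    have : Encodable.encode (Int.ofNat k) = 2 * k := rfl
    rw [this]; omega
  · obtain ⟨k, rfl⟩ := Nat.exists_eq_add_of_lt (not_le.1 hab)
    rw [if_neg hab, show (a : ℤ) - (a + k + 1 : ℕ) = Int.negSucc k by
      push_cast; rw [Int.negSucc_eq]; ring]
    have : Encodable.encode (Int.negSucc k) = 2 * k + 1 := rfl
    rw [this]; omega

/-- Writing each integer as positive part minus negative part reduces addition to natural numbers
followed by one `nat_sub_int`. Multiplication and order are treated the same way. -/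
theorem Primrec.int_add : Primrec₂ ((· + ·) : ℤ → ℤ → ℤ) :=
  (Primrec.nat_sub_int.comp
    (Primrec.nat_add.comp (int_toNat.comp .fst) (int_toNat.comp .snd))
    (Primrec.nat_add.comp (int_neg_toNat.comp .fst) (int_neg_toNat.comp .snd))).to₂.of_eq
      fun a b => by dsimp only; omega

theorem Primrec.int_mul : Primrec₂ ((· * ·) : ℤ → ℤ → ℤ) :=
  (Primrec.nat_sub_int.comp
    (Primrec.nat_add.comp (Primrec.nat_mul.comp (int_toNat.comp .fst) (int_toNat.comp .snd))
      (Primrec.nat_mul.comp (int_neg_toNat.comp .fst) (int_neg_toNat.comp .snd)))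
    (Primrec.nat_add.comp (Primrec.nat_mul.comp (int_toNat.comp .fst) (int_neg_toNat.comp .snd))
      (Primrec.nat_mul.comp (int_neg_toNat.comp .fst) (int_toNat.comp .snd)))).to₂.of_eq
      fun a b => by
        conv_rhs => rw [← Int.toNat_sub_toNat_neg a, ← Int.toNat_sub_toNat_neg b]
        push_cast
        ring

theorem PrimrecRel.int_le : PrimrecRel ((· ≤ ·) : ℤ → ℤ → Prop) :=
  (Primrec.nat_le.comp
    (Primrec.nat_add.comp (Primrec.int_toNat.comp .fst) (Primrec.int_neg_toNat.comp .snd))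
    (Primrec.nat_add.comp (Primrec.int_toNat.comp .snd)
      (Primrec.int_neg_toNat.comp .fst))).of_eq fun p => by omega

theorem Primrec.nat_cast_int : Primrec fun n : ℕ => (n : ℤ) :=
  (Primrec.nat_sub_int.comp .id (.const 0)).of_eq fun n => by simp

theorem Primrec.nat_gcd : Primrec₂ Nat.gcd := by
  have hd : PrimrecRel fun k n : ℕ => k ∣ n :=
    (Primrec.eq.comp (Primrec.nat_mod.comp .snd .fst) (.const 0)).of_eq fun p =>
      (Nat.dvd_iff_mod_eq_zero).symm
  have hp : PrimrecRel fun (p : ℕ × ℕ) k => k ∣ p.1 ∧ k ∣ p.2 :=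
    (hd.comp .snd (Primrec.fst.comp .fst)).and (hd.comp .snd (Primrec.snd.comp .fst))
  -- The search bound a + b also works when one argument is zero. When both are zero the search
  -- returns 0, which is the gcd.
  refine (Primrec.nat_findGreatest (Primrec.nat_add.comp .fst .snd) hp).to₂.of_eq fun a b => ?_
  dsimp only
  rw [Nat.findGreatest_eq_iff]
  refine ⟨?_, fun _ => ⟨Nat.gcd_dvd_left _ _, Nat.gcd_dvd_right _ _⟩, fun {n} h1 h2 h3 => ?_⟩
  · rcases Nat.eq_zero_or_pos a with rfl | ha
    · simp
    · exact (Nat.gcd_le_left b ha).trans (Nat.le_add_right _ _)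
  · have := Nat.dvd_gcd h3.1 h3.2
    rcases Nat.eq_zero_or_pos (a.gcd b) with h | h
    · obtain ⟨rfl, rfl⟩ := Nat.gcd_eq_zero_iff.1 h
      simp at h2; omega
    · exact absurd (Nat.le_of_dvd h this) (not_le.2 h1)

theorem Primrec.int_natAbs : Primrec Int.natAbs :=
  (Primrec.nat_add.comp int_toNat int_neg_toNat).of_eq fun z => by omega

/-! ### Rational numbers as a primitively recursively coded type -/

/-- Pairs that are the reduced numerator and denominator of a rational number. -/
def IsReducedFraction (p : ℤ × ℕ) : Prop := p.2 ≠ 0 ∧ p.1.natAbs.gcd p.2 = 1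

instance : DecidablePred IsReducedFraction := fun _ => inferInstanceAs (Decidable (_ ∧ _))

theorem primrecPred_isReducedFraction : PrimrecPred IsReducedFraction :=
  (PrimrecPred.not (Primrec.eq.comp .snd (.const 0))).and
    (Primrec.eq.comp (Primrec.nat_gcd.comp (Primrec.int_natAbs.comp .fst) .snd) (.const 1))

/-- Rational numbers as reduced fractions. -/
def ratEquivReduced : ℚ ≃ {p : ℤ × ℕ // IsReducedFraction p} where
  toFun x := ⟨ratCode x, x.den_nz, x.reduced⟩
  invFun p := ⟨p.1.1, p.1.2, p.2.1, p.2.2⟩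
  left_inv _ := rfl
  right_inv _ := rfl

instance Rat.primcodable : Primcodable ℚ :=
  letI := Primcodable.subtype primrecPred_isReducedFraction
  Primcodable.ofEquiv _ ratEquivReduced

/-- The coding of `ℚ` is transported from the subtype of reduced pairs, so a rational-valued
function may be tested on numerator and denominator. -/
theorem primrec_ratCode_iff {α : Type*} [Primcodable α] {f : α → ℚ} :
    (Primrec fun a => ratCode (f a)) ↔ Primrec f := by
  let := Primcodable.subtype primrecPred_isReducedFraction
  rw [← Primrec.of_equiv_iff ratEquivReduced]
  exact Primrec.subtype_val_iff (hp := primrecPred_isReducedFraction)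
    (f := fun a => ratEquivReduced (f a))

theorem primrec_ratCode : Primrec ratCode := primrec_ratCode_iff.2 .id

theorem Primrec.rat_num : Primrec Rat.num := Primrec.fst.comp primrec_ratCode

theorem Primrec.rat_den : Primrec Rat.den := Primrec.snd.comp primrec_ratCode

theorem Primrec.mkRat : Primrec₂ mkRat := by
  have hg : Primrec fun p : ℤ × ℕ => p.1.natAbs.gcd p.2 :=
    Primrec.nat_gcd.comp (Primrec.int_natAbs.comp .fst) .snd
  -- Division by the gcd is exact, so it can be done in `ℕ` on the positive and negative parts.
  -- Denominator 0 gives the rational 0, whose code is (0, 1).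
  have h : Primrec fun p : ℤ × ℕ => if p.2 = 0 then ((0, 1) : ℤ × ℕ) else
      (((p.1.toNat / p.1.natAbs.gcd p.2 : ℕ) : ℤ) - ((-p.1).toNat / p.1.natAbs.gcd p.2 : ℕ),
        p.2 / p.1.natAbs.gcd p.2) :=
    .ite (Primrec.eq.comp .snd (.const 0)) (.const _)
      (.pair (Primrec.nat_sub_int.comp (Primrec.nat_div.comp (Primrec.int_toNat.comp .fst) hg)
        (Primrec.nat_div.comp (Primrec.int_neg_toNat.comp .fst) hg)) (Primrec.nat_div.comp .snd hg))
  refine primrec_ratCode_iff.1 (h.of_eq fun ⟨a, b⟩ => ?_)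
  by_cases hb : b = 0
  · subst hb; simp [ratCode]
  · simp only [hb, if_false, ← Rat.normalize_eq_mkRat hb, Rat.normalize_eq, ratCode]
    congr 1
    rcases le_total 0 a with ha | ha
    · obtain ⟨n, rfl⟩ := Int.eq_ofNat_of_zero_le ha
      simp
    · obtain ⟨n, hn⟩ := Int.eq_ofNat_of_zero_le (neg_nonneg.2 ha)
      obtain rfl : a = -n := by omega
      have : ((n.gcd b : ℕ) : ℤ) ∣ n := Int.natCast_dvd_natCast.2 (Nat.gcd_dvd_left _ _)
      simp [Int.neg_ediv_of_dvd this]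

theorem Primrec.rat_add : Primrec₂ ((· + ·) : ℚ → ℚ → ℚ) :=
  (Primrec.mkRat.comp
    (Primrec.int_add.comp
      (Primrec.int_mul.comp (rat_num.comp .fst) (nat_cast_int.comp (rat_den.comp .snd)))
      (Primrec.int_mul.comp (rat_num.comp .snd) (nat_cast_int.comp (rat_den.comp .fst))))
    (Primrec.nat_mul.comp (rat_den.comp .fst) (rat_den.comp .snd))).to₂.of_eq fun a b =>
      (Rat.add_def' a b).symm

theorem Primrec.rat_mul : Primrec₂ ((· * ·) : ℚ → ℚ → ℚ) :=
  (Primrec.mkRat.comp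
    (Primrec.int_mul.comp (rat_num.comp .fst) (rat_num.comp .snd))
    (Primrec.nat_mul.comp (rat_den.comp .fst) (rat_den.comp .snd))).to₂.of_eq fun a b =>
      (Rat.mul_def' a b).symm

theorem PrimrecRel.rat_le : PrimrecRel ((· ≤ ·) : ℚ → ℚ → Prop) :=
  (PrimrecRel.int_le.comp
    (Primrec.int_mul.comp (Primrec.rat_num.comp .fst)
      (Primrec.nat_cast_int.comp (Primrec.rat_den.comp .snd)))
    (Primrec.int_mul.comp (Primrec.rat_num.comp .snd)
      (Primrec.nat_cast_int.comp (Primrec.rat_den.comp .fst)))).of_eq fun p =>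
      (Rat.le_iff p.1 p.2).symm

theorem PrimrecRel.rat_lt : PrimrecRel ((· < ·) : ℚ → ℚ → Prop) :=
  (PrimrecPred.not (PrimrecRel.rat_le.comp .snd .fst)).of_eq fun _ => not_le

/-! ### Bounded sums, bounded quantifiers and unbounded search -/

theorem Primrec.rat_sum_range {α : Type*} [Primcodable α] {n : α → ℕ} {f : α → ℕ → ℚ}
    (hn : Primrec n) (hf : Primrec₂ f) : Primrec fun a => ∑ i ∈ Finset.range (n a), f a i := by
  have h : Primrec fun a => Nat.rec (motive := fun _ => ℚ) 0 (fun i s => s + f a i) (n a) :=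
    Primrec.nat_rec' hn (.const 0) (Primrec.rat_add.comp (Primrec.snd.comp .snd)
      (hf.comp .fst (Primrec.fst.comp .snd))).to₂
  refine h.of_eq fun a => ?_
  induction n a with
  | zero => rfl
  | succ k ih => rw [Finset.sum_range_succ, ← ih]

theorem PrimrecPred.forall_lt_comp {α : Type*} [Primcodable α] {n : α → ℕ} {R : α → ℕ → Prop}
    (hn : Primrec n) (hR : PrimrecRel R) : PrimrecPred fun a => ∀ i < n a, R a i :=
  (hR.swap.forall_mem_list.comp (Primrec.list_range.comp hn) .id).of_eq fun a => by
    simp [Function.swap]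

theorem PrimrecPred.exists_lt_comp {α : Type*} [Primcodable α] {n : α → ℕ} {R : α → ℕ → Prop}
    (hn : Primrec n) (hR : PrimrecRel R) : PrimrecPred fun a => ∃ i < n a, R a i :=
  (hR.swap.exists_mem_list.comp (Primrec.list_range.comp hn) .id).of_eq fun a => by
    simp [Function.swap]

theorem PrimrecPred.imp {α : Type*} [Primcodable α] {p q : α → Prop} (hp : PrimrecPred p)
    (hq : PrimrecPred q) : PrimrecPred fun a => p a → q a :=
  (hp.not.or hq).of_eq fun _ => by tauto

/-- A predicate is computable if both its positive and its negative instances have certificates that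
can be checked. -/
theorem computablePred_of_certificates {α β : Type*} [Primcodable α] [Primcodable β] [Inhabited β]
    {p : α → Prop} {R R' : α → β → Prop} (hR : PrimrecRel R) (hR' : PrimrecRel R')
    (h : ∀ a, p a ↔ ∃ b, R a b) (h' : ∀ a, ¬ p a ↔ ∃ b, R' a b) : ComputablePred p := by
  classical
  -- Numbers that code nothing are sent to the default, which makes the enumeration total while it
  -- still reaches every certificate.
  let d : ℕ → β := fun n => (Encodable.decode n : Option β).getD default
  have hd : Primrec d := Primrec.option_getD_default.comp .decode
  have hsurj : ∀ b, ∃ n, d n = b := fun b => ⟨Encodable.encode b, by simp [d]⟩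
  -- Searching for either kind of certificate always terminates. Afterwards it is enough to test
  -- which kind was found, since the two kinds exclude each other.
  let P : α → ℕ → Prop := fun a n => R a (d n) ∨ R' a (d n)
  have hP : PrimrecRel P :=
    (hR.comp .fst (hd.comp .snd)).or (hR'.comp .fst (hd.comp .snd))
  have hex : ∀ a, ∃ n, P a n := fun a => by
    by_cases ha : p a
    · obtain ⟨b, hb⟩ := (h a).1 ha
      obtain ⟨n, rfl⟩ := hsurj b
      exact ⟨n, Or.inl hb⟩
    · obtain ⟨b, hb⟩ := (h' a).1 ha
      obtain ⟨n, rfl⟩ := hsurj b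
      exact ⟨n, Or.inr hb⟩
  have hf := Computable.find hP.computablePred hex
  have hR2 : PrimrecRel fun a n => R a (d n) := hR.comp .fst (hd.comp .snd)
  refine Computable.computablePred ((hR2.decide.to_comp.comp .id hf).of_eq fun a => ?_)
  refine decide_eq_decide.2 ⟨fun hb => (h a).2 ⟨_, hb⟩, fun ha => ?_⟩
  exact (Nat.find_spec (hex a)).resolve_right fun hb => (h' a).2 ⟨_, hb⟩ ha

/-! ### Discounted sums of bounded sequences -/

theorem summable_discount {c C : ℝ} (h0 : 0 ≤ c) (h1 : c < 1) {v : ℕ → ℝ} (hv : ∀ i, |v i| ≤ C) :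
    Summable fun i => c ^ i * v i := by
  refine Summable.of_norm_bounded ((summable_geometric_of_lt_one h0 h1).mul_right C) fun i => ?_
  rw [Real.norm_eq_abs, abs_mul, abs_of_nonneg (pow_nonneg h0 i)]
  exact mul_le_mul_of_nonneg_left (hv i) (pow_nonneg h0 i)

/-- Multiplied by c^i, the inequalities telescope. The remainder c^k u_k vanishes in the limit
because u is bounded. -/
theorem discSum_le_of_potential {c C : ℝ} (h0 : 0 ≤ c) (h1 : c < 1) {v : ℕ → ℚ} {u : ℕ → ℝ}
    (hv : ∀ i, |(v i : ℝ)| ≤ C) (hu : ∀ i, |u i| ≤ C) (h : ∀ i, v i + c * u (i + 1) ≤ u i) :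
    discSum c v ≤ u 0 := by
  have hsum := (summable_discount h0 h1 hv).hasSum.tendsto_sum_nat
  have hu' := (summable_discount h0 h1 hu).tendsto_atTop_zero
  have hle : ∀ k, ∑ i ∈ Finset.range k, c ^ i * (v i : ℝ) + c ^ k * u k ≤ u 0 := fun k => by
    induction k with
    | zero => simp
    | succ k ih =>
      rw [Finset.sum_range_succ]
      have := mul_le_mul_of_nonneg_left (h k) (pow_nonneg h0 k)
      rw [pow_succ]
      linarith
  simpa [discSum] using le_of_tendsto' (hsum.add hu') hle

theorem le_discSum_of_potential {c C : ℝ} (h0 : 0 ≤ c) (h1 : c < 1) {v : ℕ → ℚ} {u : ℕ → ℝ}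
    (hv : ∀ i, |(v i : ℝ)| ≤ C) (hu : ∀ i, |u i| ≤ C) (h : ∀ i, u i ≤ v i + c * u (i + 1)) :
    u 0 ≤ discSum c v := by
  have := discSum_le_of_potential (v := fun i => - v i) (u := fun i => - u i) (C := C) h0 h1
    (by simpa using hv) (by simpa using hu) (fun i => by push_cast; linarith [h i])
  simp only [discSum, Rat.cast_neg, mul_neg, tsum_neg] at this ⊢
  linarith

theorem abs_discSum_le {c C : ℝ} (h0 : 0 ≤ c) (h1 : c < 1) {v : ℕ → ℚ}
    (hv : ∀ i, |(v i : ℝ)| ≤ C) : |discSum c v| ≤ C / (1 - c) := by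
  have h := summable_discount h0 h1 hv
  have hg := (hasSum_geometric_of_lt_one h0 h1).mul_right C
  rw [discSum, ← Real.norm_eq_abs, div_eq_inv_mul]
  refine tsum_of_norm_bounded hg fun i => ?_
  rw [Real.norm_eq_abs, abs_mul, abs_of_nonneg (pow_nonneg h0 i)]
  exact mul_le_mul_of_nonneg_left (hv i) (pow_nonneg h0 i)

/-- The discounted sum is continuous: sequences with a long common prefix have close values. -/
theorem exists_prefix_discSum_close {c C : ℝ} (h0 : 0 ≤ c) (h1 : c < 1) {ε : ℝ} (hε : 0 < ε) :
    ∃ k : ℕ, ∀ v v' : ℕ → ℚ, (∀ i, |(v i : ℝ)| ≤ C) → (∀ i, |(v' i : ℝ)| ≤ C) →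
      (∀ i < k, v i = v' i) → |discSum c v - discSum c v'| < ε := by
  -- After the common prefix cancels, the difference is c^k times a difference of two tails, each
  -- bounded by C / (1 - c).
  have ht : Filter.Tendsto (fun k : ℕ => c ^ k * (2 * (C / (1 - c)))) Filter.atTop (nhds 0) := by
    simpa using (tendsto_pow_atTop_nhds_zero_of_lt_one h0 h1).mul_const (2 * (C / (1 - c)))
  obtain ⟨k, hk⟩ := (ht.eventually (gt_mem_nhds hε)).exists
  refine ⟨k, fun v v' hv hv' hvv => lt_of_le_of_lt ?_ hk⟩
  have split : ∀ x : ℕ → ℚ, (∀ i, |(x i : ℝ)| ≤ C) → discSum c x =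
      ∑ i ∈ Finset.range k, c ^ i * (x i : ℝ) + c ^ k * discSum c fun i => x (i + k) := by
    intro x hx
    rw [discSum, ← (summable_discount h0 h1 hx).sum_add_tsum_nat_add k, discSum, ← tsum_mul_left]
    simp only [pow_add]
    congr 2; ext i; ring
  have e : ∑ i ∈ Finset.range k, c ^ i * (v i : ℝ) = ∑ i ∈ Finset.range k, c ^ i * (v' i : ℝ) :=
    Finset.sum_congr rfl fun i hi => by rw [hvv i (Finset.mem_range.1 hi)]
  rw [split v hv, split v' hv', e, add_sub_add_left_eq_sub, ← mul_sub, abs_mul,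
    abs_of_nonneg (pow_nonneg h0 k)]
  refine mul_le_mul_of_nonneg_left ?_ (pow_nonneg h0 k)
  refine (abs_sub _ _).trans ?_
  rw [two_mul]
  exact add_le_add (abs_discSum_le h0 h1 fun i => hv _) (abs_discSum_le h0 h1 fun i => hv' _)

/-! ### Bellman equations -/

/-- The comparison principle for discounted Bellman inequalities. -/
theorem nonpos_of_le_discount {Q : Type*} [Finite Q] {c : ℚ} (h1 : c < 1) {f : Q → ℚ}
    (h : ∀ q, ∃ q', f q ≤ c * f q') (h0 : 0 ≤ c) (q : Q) : f q ≤ 0 := by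
  have : Nonempty Q := ⟨q⟩
  -- At a maximiser, f m ≤ c f q' ≤ c f m, and c < 1 forces f m ≤ 0.
  obtain ⟨m, hm⟩ := Finite.exists_max f
  obtain ⟨q', hq'⟩ := h m
  have := mul_le_mul_of_nonneg_left (hm q') h0
  have : f m ≤ 0 := by nlinarith
  exact (hm q).trans this

/-- The value of a fixed successor function. -/
theorem exists_policy_value {Q : Type*} [Finite Q] {c : ℚ} (h0 : 0 ≤ c) (h1 : c < 1)
    (g : Q → ℚ) (s : Q → Q) : ∃ V : Q → ℚ, ∀ q, V q = g q + c * V (s q) := by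
  -- The comparison principle, applied to V and -V, shows that this operator is injective. In finite
  -- dimension it is then surjective, and working over `ℚ` makes the value rational.
  let T : (Q → ℚ) →ₗ[ℚ] (Q → ℚ) := LinearMap.id - c • LinearMap.funLeft ℚ ℚ s
  have hT : ∀ V q, T V q = V q - c * V (s q) := fun V q => by simp [T, LinearMap.funLeft_apply]
  have hinj : Function.Injective T := by
    rw [← LinearMap.ker_eq_bot, LinearMap.ker_eq_bot']
    intro V hV
    have e : ∀ q, V q = c * V (s q) := fun q => by
      have := hT V q; rw [hV, Pi.zero_apply] at this; linarith
    funext q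
    refine le_antisymm (nonpos_of_le_discount h1 (fun q => ⟨s q, (e q).le⟩) h0 q) ?_
    have := nonpos_of_le_discount (f := fun q => - V q) h1
      (fun q => ⟨s q, by rw [e q]; linarith⟩) h0 q
    simpa using this
  obtain ⟨V, hV⟩ := LinearMap.surjective_of_injective hinj g
  refine ⟨V, fun q => ?_⟩
  have := hT V q; rw [hV] at this; linarith

/-- The Bellman equation for the maximal discounted sum has a rational solution. -/
theorem exists_bellman_solution {Q S : Type*} [Finite Q] [Finite S] {c : ℚ} (h0 : 0 ≤ c)
    (h1 : c < 1) (E : Q → S → Q → Prop) (W : Q → S → Q → ℚ) (hE : ∀ q, ∃ a q', E q a q') :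
    ∃ V : Q → ℚ, (∀ q a q', E q a q' → W q a q' + c * V q' ≤ V q) ∧
      ∀ q, ∃ a q', E q a q' ∧ V q = W q a q' + c * V q' := by
  classical
  let Pol := {σ : Q → S × Q // ∀ q, E q (σ q).1 (σ q).2}
  have : Nonempty Pol := by
    choose a q' h using hE
    exact ⟨fun q => (a q, q' q), h⟩
  cases nonempty_fintype Q
  have hval : ∀ σ : Pol, ∃ V : Q → ℚ, ∀ q, V q = W q (σ.1 q).1 (σ.1 q).2 + c * V (σ.1 q).2 :=
    fun σ => exists_policy_value h0 h1 (fun q => W q (σ.1 q).1 (σ.1 q).2) fun q => (σ.1 q).2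
  choose V hV using hval
  -- Maximising the sum of the values over all states suffices, since a local improvement lowers no
  -- state's value.
  obtain ⟨σ, hσ⟩ := Finite.exists_max fun σ : Pol => ∑ q, V σ q
  refine ⟨V σ, fun p a p' hp => ?_, fun q => ⟨_, _, σ.2 q, hV σ q⟩⟩
  by_contra! hlt
  -- Policy improvement: if an edge at p violates the inequality, redirect p along it. The old value
  -- is a subsolution for the new policy, so by comparison the new value dominates it, strictly at
  -- p.
  let τ : Pol := ⟨Function.update σ.1 p (a, p'), fun q => by
    by_cases hq : q = p
    · subst hq; simpa using hp
    · simpa [hq] using σ.2 q⟩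
  have himp : ∀ q, V σ q ≤ W q (τ.1 q).1 (τ.1 q).2 + c * V σ (τ.1 q).2 := fun q => by
    by_cases hq : q = p
    · subst hq; simpa [τ] using hlt.le
    · simpa [τ, hq] using (hV σ q).le
  have hle : ∀ q, V σ q ≤ V τ q := fun q => by
    have := nonpos_of_le_discount (f := fun q => V σ q - V τ q) h1
      (fun q => ⟨(τ.1 q).2, by linarith [himp q, hV τ q]⟩) h0 q
    linarith
  have hlt' : V σ p < V τ p := by
    have e : V τ p = W p a p' + c * V τ p' := by simpa [τ] using hV τ p
    have := mul_le_mul_of_nonneg_left (hle p') h0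
    linarith
  exact (hσ τ).not_gt (Finset.sum_lt_sum (fun q _ => hle q) ⟨p, Finset.mem_univ _, hlt'⟩)

/-! ### The values of words as extremal values of runs -/

namespace ProbWeightedAutomaton

theorem exists_weights_bound {Q S : Type*} [Fintype Q] [Finite S]
    (A : ProbWeightedAutomaton Q S) :
    ∃ C : ℝ, ∀ w r i, |(A.weights w r i : ℝ)| ≤ C := by
  obtain ⟨C, hC⟩ := (Set.finite_range fun p : Q × S × Q => |(A.weight p.1 p.2.1 p.2.2 : ℝ)|).bddAbove
  exact ⟨C, fun w r i => hC ⟨(r i, w i, r (i + 1)), rfl⟩⟩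

variable {Q S : Type*} [Fintype Q] [MeasurableSpace Q] [DiscreteMeasurableSpace Q]

instance (A : ProbWeightedAutomaton Q S) (w : ℕ → S) : IsProbabilityMeasure (A.runMeasure w) := by
  have : IsProbabilityMeasure (pmfOfSimplex A.init A.init_mem).toMeasure := inferInstance
  unfold runMeasure; infer_instance

theorem measurableSet_cylinder (s : ℕ → Q) (k : ℕ) :
    MeasurableSet {r : ℕ → Q | ∀ i ≤ k, r i = s i} := by
  have : {r : ℕ → Q | ∀ i ≤ k, r i = s i} = ⋂ i ∈ Finset.Iic k, (fun r => r i) ⁻¹' {s i} := by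
    ext r; simp
  rw [this]
  exact Finset.measurableSet_biInter _ fun i _ => (measurable_pi_apply i) (measurableSet_singleton _)

/-- Almost every state sequence is a run. -/
theorem ae_isRun (A : ProbWeightedAutomaton Q S) (w : ℕ → S) :
    ∀ᵐ r ∂A.runMeasure w, A.IsRun w r := by
  have key : ∀ k, ∀ᵐ r ∂A.runMeasure w,
      0 < A.init (r 0) * ∏ i ∈ Finset.range k, A.trans (r i) (w i) (r (i + 1)) := by
    intro k
    rw [ae_iff]
    -- Histories are continued arbitrarily, here by their initial state, because the cylinder
    -- formula takes infinite sequences.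
    let ext : (Finset.Iic k → Q) → ℕ → Q := fun s i =>
      if h : i ∈ Finset.Iic k then s ⟨i, h⟩ else s ⟨0, by simp⟩
    let bad : Set (Finset.Iic k → Q) := {s | ¬ 0 < A.init (ext s 0) *
      ∏ i ∈ Finset.range k, A.trans (ext s i) (w i) (ext s (i + 1))}
    refine measure_mono_null (t := ⋃ s ∈ bad, {r : ℕ → Q | ∀ i ≤ k, r i = ext s i})
      (fun r hr => ?_) ?_
    · have hex : ∀ i ≤ k, r i = ext (fun j => r j) i := fun i hi => by simp [ext, hi]
      refine Set.mem_iUnion₂.2 ⟨fun j => r j, ?_, hex⟩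
      change ¬ _ at hr ⊢
      rwa [← hex 0 (Nat.zero_le _), Finset.prod_congr rfl fun i hi => by
        rw [← hex i (Finset.mem_range.1 hi).le, ← hex (i + 1) (Finset.mem_range.1 hi)]]
    · refine (measure_biUnion_null_iff (Set.to_countable _)).2 fun s hs => ?_
      rw [runMeasure_cylinder]
      exact ENNReal.ofReal_eq_zero.2 (not_lt.1 hs)
  filter_upwards [ae_all_iff.2 key] with r hr
  refine ⟨by simpa using hr 0, fun i => ?_⟩
  have h := hr (i + 1)
  rw [Finset.prod_range_succ, ← mul_assoc] at h
  -- Two consecutive partial products are positive, hence so is their last factor.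
  exact (pos_iff_pos_of_mul_pos h).1 (hr i)

theorem IsRun.cylinder_pos {A : ProbWeightedAutomaton Q S} {w : ℕ → S} {s : ℕ → Q}
    (hs : A.IsRun w s) (k : ℕ) : 0 < A.runMeasure w {r | ∀ i ≤ k, r i = s i} := by
  rw [runMeasure_cylinder]
  exact ENNReal.ofReal_pos.2 (mul_pos hs.1 (Finset.prod_pos fun i _ => hs.2 i))

variable [Finite S]

variable {c : ℝ}

/-- The value of a word under the positive semantics is the supremum of the values of its runs. -/
theorem isLUB_posValue (A : ProbWeightedAutomaton Q S) (h0 : 0 ≤ c) (h1 : c < 1) (w : ℕ → S) :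
    IsLUB {x | ∃ r, A.IsRun w r ∧ discSum c (A.weights w r) = x} (A.posValue (discSum c) w) := by
  obtain ⟨C, hC⟩ := A.exists_weights_bound
  have habs : ∀ r, |discSum c (A.weights w r)| ≤ C / (1 - c) :=
    fun r => abs_discSum_le h0 h1 (hC w r)
  have hbdd : BddAbove {η : ℝ | 0 < A.runMeasure w
      {r | A.IsRun w r ∧ η ≤ discSum c (A.weights w r)}} := by
    refine ⟨C / (1 - c), fun η hη => ?_⟩
    obtain ⟨r, -, hr⟩ := nonempty_of_measure_ne_zero (ne_of_gt hη)
    exact hr.trans (le_of_abs_le (habs r))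
  have hmem : ∀ r, A.IsRun w r → ∀ η < discSum c (A.weights w r), 0 < A.runMeasure w
      {r | A.IsRun w r ∧ η ≤ discSum c (A.weights w r)} := by
    intro r hr η hη
    -- Every run sharing a long enough prefix with r still has value above η, and the cylinder of
    -- that prefix has positive probability.
    obtain ⟨k, hk⟩ := exists_prefix_discSum_close (C := C) h0 h1 (sub_pos.2 hη)
    refine (hr.cylinder_pos k).trans_le (measure_mono_ae ?_)
    filter_upwards [A.ae_isRun w] with r' hr' hcyl
    have hcyl : ∀ i ≤ k, r' i = r i := hcyl
    refine ⟨hr', ?_⟩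
    have := hk _ _ (hC w r) (hC w r') fun i hi => by
      rw [weights, weights, hcyl i hi.le, hcyl (i + 1) hi]
    linarith [(abs_lt.1 this).2]
  refine ⟨?_, fun b hb => ?_⟩
  · rintro x ⟨r, hr, rfl⟩
    exact le_of_forall_lt_imp_le_of_dense fun η hη => le_csSup hbdd (hmem r hr η hη)
  · obtain ⟨r, hr⟩ := (A.ae_isRun w).exists
    -- The set of admissible η must be shown nonempty, as the real supremum of the empty set is 0.
    refine csSup_le ⟨_, hmem r hr (discSum c (A.weights w r) - 1) (by linarith)⟩ fun η hη => ?_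
    obtain ⟨r, hr, hle⟩ := nonempty_of_measure_ne_zero (ne_of_gt hη)
    exact hle.trans (hb ⟨r, hr, rfl⟩)

/-- The value of a word under the almost-sure semantics is the infimum of the values of its
runs. -/
theorem isGLB_asValue (A : ProbWeightedAutomaton Q S) (h0 : 0 ≤ c) (h1 : c < 1) (w : ℕ → S) :
    IsGLB {x | ∃ r, A.IsRun w r ∧ discSum c (A.weights w r) = x} (A.asValue (discSum c) w) := by
  obtain ⟨C, hC⟩ := A.exists_weights_bound
  have habs : ∀ r, |discSum c (A.weights w r)| ≤ C / (1 - c) :=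
    fun r => abs_discSum_le h0 h1 (hC w r)
  have hmem : ∀ η, (∀ r, A.IsRun w r → η ≤ discSum c (A.weights w r)) →
      A.runMeasure w {r | A.IsRun w r ∧ η ≤ discSum c (A.weights w r)} = 1 := by
    intro η hη
    refine (measure_congr (Filter.eventuallyEq_univ.2 ?_)).trans measure_univ
    filter_upwards [A.ae_isRun w] with r hr
    exact ⟨hr, hη r hr⟩
  have hle : ∀ r, A.IsRun w r → ∀ η,
      A.runMeasure w {r | A.IsRun w r ∧ η ≤ discSum c (A.weights w r)} = 1 →
        η ≤ discSum c (A.weights w r) := by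
    intro r hr η hη
    by_contra! hlt
    -- A run of value below η has a cylinder of positive probability that misses the event, so the
    -- event cannot have probability 1.
    obtain ⟨k, hk⟩ := exists_prefix_discSum_close (C := C) h0 h1 (sub_pos.2 hlt)
    have hsub : {r | A.IsRun w r ∧ η ≤ discSum c (A.weights w r)} ⊆
        {r' : ℕ → Q | ∀ i ≤ k, r' i = r i}ᶜ := by
      rintro r' ⟨-, hr'⟩ hcyl
      have hcyl : ∀ i ≤ k, r' i = r i := hcyl
      have := hk _ _ (hC w r') (hC w r) fun i hi => by
        rw [weights, weights, hcyl i hi.le, hcyl (i + 1) hi]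
      linarith [(abs_lt.1 this).2]
    have h := measure_mono (μ := A.runMeasure w) hsub
    rw [hη, prob_compl_eq_one_sub (measurableSet_cylinder r k)] at h
    exact (ENNReal.sub_lt_self ENNReal.one_ne_top one_ne_zero
      (hr.cylinder_pos k).ne').not_ge h
  obtain ⟨r₀, hr₀⟩ := (A.ae_isRun w).exists
  refine ⟨?_, fun b hb => ?_⟩
  · rintro x ⟨r, hr, rfl⟩
    exact csSup_le ⟨-(C / (1 - c)), hmem _ fun r _ => neg_le_of_abs_le (habs r)⟩
      fun η hη => hle r hr η hη
  · exact le_csSup ⟨_, fun η hη => hle r₀ hr₀ η hη⟩ (hmem b fun r hr => hb ⟨r, hr, rfl⟩)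

end ProbWeightedAutomaton

/-! ### Certificates for the two decision problems -/

/-- A positional choice of letter and successor is iterated, producing the word and the run along it
at once. -/
theorem exists_path {Q S : Type*} {R : Q → S → Q → Prop} (h : ∀ q, ∃ a q', R q a q') (q : Q) :
    ∃ (w : ℕ → S) (r : ℕ → Q), r 0 = q ∧ ∀ i, R (r i) (w i) (r (i + 1)) := by
  choose a s hs using h
  exact ⟨fun i => a (s^[i] q), fun i => s^[i] q, rfl, fun i => by
    dsimp only; rw [Function.iterate_succ_apply']; exact hs _⟩

theorem exists_pos_of_mem_stdSimplex {Q : Type*} [Fintype Q] {f : Q → ℚ}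
    (hf : f ∈ stdSimplex ℚ Q) : ∃ q, 0 < f q := by
  by_contra! h
  have := Finset.sum_nonpos fun q (_ : q ∈ Finset.univ) => h q
  rw [hf.2] at this
  norm_num at this

namespace ProbWeightedAutomaton

variable {Q S : Type*} [Fintype Q] [Finite S] {c : ℚ}

theorem exists_weights_potential_bound (A : ProbWeightedAutomaton Q S) (U : Q → ℚ) :
    ∃ C : ℝ, (∀ w r i, |(A.weights w r i : ℝ)| ≤ C) ∧ ∀ q, |(U q : ℝ)| ≤ C := by
  obtain ⟨C, hC⟩ := A.exists_weights_bound
  obtain ⟨D, hD⟩ := (Set.finite_range fun q => |(U q : ℝ)|).bddAbove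
  exact ⟨max C D, fun w r i => (hC w r i).trans (le_max_left _ _),
    fun q => (hD ⟨q, rfl⟩).trans (le_max_right _ _)⟩

theorem discSum_weights_le (A : ProbWeightedAutomaton Q S) (h0 : 0 ≤ c) (h1 : c < 1) {U : Q → ℚ}
    {w : ℕ → S} {r : ℕ → Q} (h : ∀ i, A.weights w r i + c * U (r (i + 1)) ≤ U (r i)) :
    discSum c (A.weights w r) ≤ U (r 0) := by
  obtain ⟨C, hC, hU⟩ := A.exists_weights_potential_bound U
  exact discSum_le_of_potential (u := fun i => (U (r i) : ℝ)) (mod_cast h0) (mod_cast h1) (hC w r)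
    (fun i => hU _) fun i => mod_cast h i

theorem le_discSum_weights (A : ProbWeightedAutomaton Q S) (h0 : 0 ≤ c) (h1 : c < 1) {U : Q → ℚ}
    {w : ℕ → S} {r : ℕ → Q} (h : ∀ i, U (r i) ≤ A.weights w r i + c * U (r (i + 1))) :
    U (r 0) ≤ discSum c (A.weights w r) := by
  obtain ⟨C, hC, hU⟩ := A.exists_weights_potential_bound U
  exact le_discSum_of_potential (u := fun i => (U (r i) : ℝ)) (mod_cast h0) (mod_cast h1) (hC w r)
    (fun i => hU _) fun i => mod_cast h i

end ProbWeightedAutomaton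

namespace DiscInstance

variable (x : DiscInstance)

/-- `U` certifies that some word has value at least the threshold under the positive semantics. -/
def PosCertificate (U : Fin x.numStates → ℚ) : Prop :=
  (∀ q, ∃ a q', 0 < x.trans q a q' ∧ U q ≤ x.weight q a q' + x.discount * U q') ∧
    ∃ q, 0 < x.init q ∧ x.threshold ≤ U q

/-- `U` certifies that all words have value below the threshold under the positive semantics. -/
def PosRefutation (U : Fin x.numStates → ℚ) : Prop :=
  (∀ q a q', 0 < x.trans q a q' → x.weight q a q' + x.discount * U q' ≤ U q) ∧
    ∀ q, 0 < x.init q → U q < x.threshold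

/-- `U` certifies that all words have value at least the threshold under the almost-sure
semantics. -/
def AsCertificate (U : Fin x.numStates → ℚ) : Prop :=
  (∀ q a q', 0 < x.trans q a q' → U q ≤ x.weight q a q' + x.discount * U q') ∧
    ∀ q, 0 < x.init q → x.threshold ≤ U q

/-- `U` certifies that some word has value below the threshold under the almost-sure semantics. -/
def AsRefutation (U : Fin x.numStates → ℚ) : Prop :=
  (∀ q, ∃ a q', 0 < x.trans q a q' ∧ x.weight q a q' + x.discount * U q' ≤ U q) ∧
    ∃ q, 0 < x.init q ∧ U q < x.threshold

variable {x}

theorem isLUB_posValue (w : ℕ → Fin x.numLetters) :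
    IsLUB {y | ∃ r, x.automaton.IsRun w r ∧
      discSum x.discount (x.automaton.weights w r) = y}
      (x.automaton.posValue (discSum x.discount) w) :=
  x.automaton.isLUB_posValue (mod_cast x.discount_pos.le) (mod_cast x.discount_lt_one) w

theorem isGLB_asValue (w : ℕ → Fin x.numLetters) :
    IsGLB {y | ∃ r, x.automaton.IsRun w r ∧
      discSum x.discount (x.automaton.weights w r) = y}
      (x.automaton.asValue (discSum x.discount) w) :=
  x.automaton.isGLB_asValue (mod_cast x.discount_pos.le) (mod_cast x.discount_lt_one) w

theorem isRun_iff {w : ℕ → Fin x.numLetters} {r : ℕ → Fin x.numStates} :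
    x.automaton.IsRun w r ↔ 0 < x.init (r 0) ∧ ∀ i, 0 < x.trans (r i) (w i) (r (i + 1)) := by
  simp [ProbWeightedAutomaton.IsRun, automaton]

theorem PosCertificate.posNonempty {U : Fin x.numStates → ℚ} (h : x.PosCertificate U) :
    x.PosNonempty := by
  obtain ⟨hU, q, hq, hν⟩ := h
  obtain ⟨w, r, rfl, hr⟩ := exists_path hU q
  refine ⟨w, ?_⟩
  have hd := x.automaton.le_discSum_weights x.discount_pos.le x.discount_lt_one (U := U)
    (w := w) (r := r) fun i => (hr i).2
  exact (Rat.cast_le.2 hν).trans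
    (hd.trans ((isLUB_posValue w).1 ⟨r, isRun_iff.2 ⟨hq, fun i => (hr i).1⟩, rfl⟩))

theorem PosRefutation.not_posNonempty {U : Fin x.numStates → ℚ} (h : x.PosRefutation U) :
    ¬ x.PosNonempty := by
  rintro ⟨w, hw⟩
  obtain ⟨hU, hν⟩ := h
  obtain ⟨q₀, hq₀⟩ := exists_pos_of_mem_stdSimplex x.init_mem
  -- The strict inequality survives the supremum over runs because the initial support is finite and
  -- nonempty, so a single U m bounds all runs.
  obtain ⟨m, hm, hmax⟩ := Finset.exists_max_image (Finset.univ.filter fun q => 0 < x.init q) U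
    ⟨q₀, by simpa using hq₀⟩
  have hle : x.automaton.posValue (discSum x.discount) w ≤ U m := by
    refine (isLUB_posValue w).2 ?_
    rintro y ⟨r, hr, rfl⟩
    obtain ⟨hr0, hr⟩ := isRun_iff.1 hr
    refine (x.automaton.discSum_weights_le x.discount_pos.le x.discount_lt_one (U := U)
      (w := w) (r := r) fun i => hU _ _ _ (hr i)).trans ?_
    exact_mod_cast hmax _ (by simpa using hr0)
  exact (hν m (by simpa using hm)).not_ge (Rat.cast_le.1 (hw.trans hle))

theorem AsCertificate.asUniversal {U : Fin x.numStates → ℚ} (h : x.AsCertificate U) :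
    x.AsUniversal := by
  intro w
  obtain ⟨hU, hν⟩ := h
  refine (isGLB_asValue w).2 ?_
  rintro y ⟨r, hr, rfl⟩
  obtain ⟨hr0, hr⟩ := isRun_iff.1 hr
  exact (Rat.cast_le.2 (hν _ hr0)).trans (x.automaton.le_discSum_weights x.discount_pos.le
    x.discount_lt_one (U := U) (w := w) (r := r) fun i => hU _ _ _ (hr i))

theorem AsRefutation.not_asUniversal {U : Fin x.numStates → ℚ} (h : x.AsRefutation U) :
    ¬ x.AsUniversal := by
  intro hx
  obtain ⟨hU, q, hq, hν⟩ := h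
  obtain ⟨w, r, rfl, hr⟩ := exists_path hU q
  have hd := x.automaton.discSum_weights_le x.discount_pos.le x.discount_lt_one (U := U)
    (w := w) (r := r) fun i => (hr i).2
  have := (hx w).trans
    (((isGLB_asValue w).1 ⟨r, isRun_iff.2 ⟨hq, fun i => (hr i).1⟩, rfl⟩).trans hd)
  exact hν.not_ge (Rat.cast_le.1 this)

theorem exists_edge (h : 0 < x.numLetters) (q : Fin x.numStates) :
    ∃ a q', 0 < x.trans q a q' :=
  ⟨⟨0, h⟩, exists_pos_of_mem_stdSimplex (x.trans_mem q _)⟩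

/-- The Bellman solution satisfies both one-sided inequalities, so comparing it with the threshold
at the initial states decides which role it plays. With soundness this makes certificates and
refutations complete. -/
theorem exists_posCertificate_or_posRefutation :
    (∃ U, x.PosCertificate U) ∨ ∃ U, x.PosRefutation U := by
  rcases Nat.eq_zero_or_pos x.numLetters with h | h
  -- Without letters there are no words: the edge condition is vacuous and a constant below the
  -- threshold refutes nonemptiness.
  · exact Or.inr ⟨fun _ => x.threshold - 1, fun q a => absurd a.2 (by omega), fun q _ => by simp⟩
  · obtain ⟨V, hle, heq⟩ := exists_bellman_solution x.discount_pos.le x.discount_lt_one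
      (fun q a q' => 0 < x.trans q a q') x.weight (exists_edge h)
    by_cases hq : ∃ q, 0 < x.init q ∧ x.threshold ≤ V q
    · exact Or.inl ⟨V, fun q => (heq q).imp fun a => Exists.imp fun q' h => ⟨h.1, h.2.le⟩, hq⟩
    · push Not at hq
      exact Or.inr ⟨V, hle, hq⟩

theorem exists_asCertificate_or_asRefutation :
    (∃ U, x.AsCertificate U) ∨ ∃ U, x.AsRefutation U := by
  rcases Nat.eq_zero_or_pos x.numLetters with h | h
  · exact Or.inl ⟨fun _ => x.threshold, fun q a => absurd a.2 (by omega), fun q _ => le_rfl⟩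
  · obtain ⟨V, hle, heq⟩ := exists_bellman_solution x.discount_pos.le x.discount_lt_one
      -- Negating the weights turns the maximal discounted sum into the minimal one.
      (fun q a q' => 0 < x.trans q a q') (fun q a q' => - x.weight q a q') (exists_edge h)
    by_cases hq : ∃ q, 0 < x.init q ∧ - V q < x.threshold
    · exact Or.inr ⟨fun q => - V q, fun q => (heq q).imp fun a => Exists.imp fun q' h =>
        ⟨h.1, by linarith [h.2]⟩, hq⟩
    · push Not at hq
      exact Or.inl ⟨fun q => - V q, fun q a q' h => by linarith [hle q a q' h], hq⟩

theorem posNonempty_iff : x.PosNonempty ↔ ∃ U, x.PosCertificate U :=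
  ⟨fun h => exists_posCertificate_or_posRefutation.resolve_right
    fun ⟨_, hU⟩ => hU.not_posNonempty h, fun ⟨_, hU⟩ => hU.posNonempty⟩

theorem not_posNonempty_iff : ¬ x.PosNonempty ↔ ∃ U, x.PosRefutation U :=
  ⟨fun h => exists_posCertificate_or_posRefutation.resolve_left
    fun ⟨_, hU⟩ => h hU.posNonempty, fun ⟨_, hU⟩ => hU.not_posNonempty⟩

theorem asUniversal_iff : x.AsUniversal ↔ ∃ U, x.AsCertificate U :=
  ⟨fun h => exists_asCertificate_or_asRefutation.resolve_right
    fun ⟨_, hU⟩ => hU.not_asUniversal h, fun ⟨_, hU⟩ => hU.asUniversal⟩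

theorem not_asUniversal_iff : ¬ x.AsUniversal ↔ ∃ U, x.AsRefutation U :=
  ⟨fun h => exists_asCertificate_or_asRefutation.resolve_left
    fun ⟨_, hU⟩ => h hU.asUniversal, fun ⟨_, hU⟩ => hU.not_asUniversal⟩

end DiscInstance

/-! ### Reading instances from their codes -/

/-- The rational number with the given numerator and denominator. -/
def ratOfCode (p : ℤ × ℕ) : ℚ := mkRat p.1 p.2

@[simp]
theorem ratOfCode_ratCode (x : ℚ) : ratOfCode (ratCode x) = x := Rat.mkRat_self x

theorem primrec_ratOfCode : Primrec ratOfCode := Primrec.mkRat.comp .fst .snd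

theorem List.ofFn_eq_map_range {α : Type*} {n : ℕ} {f : Fin n → α} {g : ℕ → α}
    (h : ∀ i : Fin n, f i = g i) : List.ofFn f = (List.range n).map g := by
  refine List.ext_getElem (by simp) fun i h1 h2 => ?_
  simpa using h ⟨i, by simpa using h1⟩

theorem List.getD_ofFn {α : Type*} {n : ℕ} (f : Fin n → α) (i : Fin n) (d : α) :
    (List.ofFn f).getD i d = f i := by
  simp [List.getD_eq_getElem?_getD]

namespace DiscCode

/-- The initial probability of a state. -/
def initAt (c : DiscCode) (q : ℕ) : ℚ := ratOfCode (c.2.1.1.getD q (0, 1))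

/-- An entry of a table on `Q × S × Q`. -/
def tableAt (t : List (List (List (ℤ × ℕ)))) (q a q' : ℕ) : ℚ :=
  ratOfCode (((t.getD q []).getD a []).getD q' (0, 1))

/-- The transition probabilities. -/
def transAt (c : DiscCode) : ℕ → ℕ → ℕ → ℚ := tableAt c.2.1.2.1

/-- The weights. -/
def weightAt (c : DiscCode) : ℕ → ℕ → ℕ → ℚ := tableAt c.2.1.2.2

/-- The discount factor. -/
def discount (c : DiscCode) : ℚ := ratOfCode c.2.2.1

/-- The threshold. -/
def threshold (c : DiscCode) : ℚ := ratOfCode c.2.2.2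

/-- The code of a table with the given entries. -/
def rebuildTable (n m : ℕ) (t : List (List (List (ℤ × ℕ)))) : List (List (List (ℤ × ℕ))) :=
  (List.range n).map fun q => (List.range m).map fun a => (List.range n).map fun q' =>
    ratCode (tableAt t q a q')

/-- The code with the same entries, of the right dimensions and with reduced fractions. -/
def rebuild (c : DiscCode) : DiscCode :=
  (c.1, ((List.range c.1.1).map fun q => ratCode (initAt c q),
    rebuildTable c.1.1 c.1.2 c.2.1.2.1, rebuildTable c.1.1 c.1.2 c.2.1.2.2),
    (ratCode (discount c), ratCode (threshold c)))

/-- The codes that describe an instance. -/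
def Valid (c : DiscCode) : Prop :=
  rebuild c = c ∧
    ((∀ q < c.1.1, 0 ≤ initAt c q) ∧ ∑ q ∈ Finset.range c.1.1, initAt c q = 1) ∧
    (∀ q < c.1.1, ∀ a < c.1.2, (∀ q' < c.1.1, 0 ≤ transAt c q a q') ∧
      ∑ q' ∈ Finset.range c.1.1, transAt c q a q' = 1) ∧
    0 < discount c ∧ discount c < 1

section Primrec

variable {α : Type*} [Primcodable α] {f : α → DiscCode} {q a q' : α → ℕ}

theorem primrec_initAt (hf : Primrec f) (hq : Primrec q) :
    Primrec fun x => initAt (f x) (q x) :=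
  primrec_ratOfCode.comp ((Primrec.list_getD _).comp
    (Primrec.fst.comp (Primrec.fst.comp (Primrec.snd.comp hf))) hq)

theorem primrec_tableAt {t : α → List (List (List (ℤ × ℕ)))} (ht : Primrec t) (hq : Primrec q)
    (ha : Primrec a) (hq' : Primrec q') : Primrec fun x => tableAt (t x) (q x) (a x) (q' x) :=
  primrec_ratOfCode.comp ((Primrec.list_getD _).comp ((Primrec.list_getD _).comp
    ((Primrec.list_getD _).comp ht hq) ha) hq')

theorem primrec_transTable : Primrec fun c : DiscCode => c.2.1.2.1 :=
  Primrec.fst.comp (Primrec.snd.comp (Primrec.fst.comp .snd))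

theorem primrec_weightTable : Primrec fun c : DiscCode => c.2.1.2.2 :=
  Primrec.snd.comp (Primrec.snd.comp (Primrec.fst.comp .snd))

theorem primrec_transAt (hf : Primrec f) (hq : Primrec q) (ha : Primrec a) (hq' : Primrec q') :
    Primrec fun x => transAt (f x) (q x) (a x) (q' x) :=
  primrec_tableAt (primrec_transTable.comp hf) hq ha hq'

theorem primrec_weightAt (hf : Primrec f) (hq : Primrec q) (ha : Primrec a) (hq' : Primrec q') :
    Primrec fun x => weightAt (f x) (q x) (a x) (q' x) :=
  primrec_tableAt (primrec_weightTable.comp hf) hq ha hq'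

theorem primrec_discount (hf : Primrec f) : Primrec fun x => discount (f x) :=
  primrec_ratOfCode.comp (Primrec.fst.comp (Primrec.snd.comp (Primrec.snd.comp hf)))

theorem primrec_threshold (hf : Primrec f) : Primrec fun x => threshold (f x) :=
  primrec_ratOfCode.comp (Primrec.snd.comp (Primrec.snd.comp (Primrec.snd.comp hf)))

theorem primrec_numStates (hf : Primrec f) : Primrec fun x => (f x).1.1 :=
  Primrec.fst.comp (Primrec.fst.comp hf)

theorem primrec_numLetters (hf : Primrec f) : Primrec fun x => (f x).1.2 :=
  Primrec.snd.comp (Primrec.fst.comp hf)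

theorem primrec_rebuildTable {t : α → List (List (List (ℤ × ℕ)))} (hq : Primrec q)
    (ha : Primrec a) (ht : Primrec t) : Primrec fun x => rebuildTable (q x) (a x) (t x) := by
  refine Primrec.list_map (Primrec.list_range.comp hq) (Primrec₂.mk ?_)
  refine Primrec.list_map (Primrec.list_range.comp (ha.comp .fst)) (Primrec₂.mk ?_)
  refine Primrec.list_map (Primrec.list_range.comp (hq.comp (Primrec.fst.comp .fst)))
    (Primrec₂.mk ?_)
  exact primrec_ratCode.comp (primrec_tableAt
    (ht.comp (Primrec.fst.comp (Primrec.fst.comp .fst)))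
    (Primrec.snd.comp (Primrec.fst.comp .fst)) (Primrec.snd.comp .fst) .snd)

theorem primrec_rebuild : Primrec rebuild :=
  .pair .fst (.pair (.pair
    (Primrec.list_map (Primrec.list_range.comp (primrec_numStates .id))
      (primrec_ratCode.comp (primrec_initAt .fst .snd)).to₂)
    (.pair (primrec_rebuildTable (primrec_numStates .id) (primrec_numLetters .id)
        primrec_transTable)
      (primrec_rebuildTable (primrec_numStates .id) (primrec_numLetters .id)
        primrec_weightTable)))
    (.pair (primrec_ratCode.comp (primrec_discount .id))
      (primrec_ratCode.comp (primrec_threshold .id))))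

theorem primrecPred_valid : PrimrecPred Valid := by
  refine (Primrec.eq.comp primrec_rebuild .id).and (.and (.and ?_ ?_) (.and ?_ (.and ?_ ?_)))
  · exact .forall_lt_comp (primrec_numStates .id)
      (PrimrecRel.rat_le.comp (.const 0) (primrec_initAt .fst .snd))
  · exact Primrec.eq.comp (Primrec.rat_sum_range (primrec_numStates .id)
      (primrec_initAt .fst .snd).to₂) (.const 1)
  · refine .forall_lt_comp (primrec_numStates .id) (PrimrecPred.forall_lt_comp
      (primrec_numLetters .fst) (PrimrecPred.and ?_ ?_))
    · exact .forall_lt_comp (primrec_numStates (Primrec.fst.comp .fst))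
        (PrimrecRel.rat_le.comp (.const 0) (primrec_transAt (Primrec.fst.comp (Primrec.fst.comp .fst))
          (Primrec.snd.comp (Primrec.fst.comp .fst)) (Primrec.snd.comp .fst) .snd))
    · exact Primrec.eq.comp (Primrec.rat_sum_range (primrec_numStates (Primrec.fst.comp .fst))
        (primrec_transAt (Primrec.fst.comp (Primrec.fst.comp .fst))
          (Primrec.snd.comp (Primrec.fst.comp .fst)) (Primrec.snd.comp .fst) .snd).to₂) (.const 1)
  · exact PrimrecRel.rat_lt.comp (.const 0) (primrec_discount .id)
  · exact PrimrecRel.rat_lt.comp (primrec_discount .id) (.const 1)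

end Primrec

@[simp]
theorem initAt_encode (x : DiscInstance) (q : Fin x.numStates) :
    initAt x.encode q = x.init q := by
  simp [initAt, DiscInstance.encode]

theorem tableAt_tableCode {n m : ℕ} (t : Fin n → Fin m → Fin n → ℚ) (q : Fin n) (a : Fin m)
    (q' : Fin n) : tableAt (tableCode t) q a q' = t q a q' := by
  simp [tableAt, tableCode]

@[simp]
theorem transAt_encode (x : DiscInstance) (q : Fin x.numStates) (a : Fin x.numLetters)
    (q' : Fin x.numStates) : transAt x.encode q a q' = x.trans q a q' :=
  tableAt_tableCode x.trans q a q'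

@[simp]
theorem weightAt_encode (x : DiscInstance) (q : Fin x.numStates) (a : Fin x.numLetters)
    (q' : Fin x.numStates) : weightAt x.encode q a q' = x.weight q a q' :=
  tableAt_tableCode x.weight q a q'

@[simp]
theorem discount_encode (x : DiscInstance) : discount x.encode = x.discount :=
  ratOfCode_ratCode _

@[simp]
theorem threshold_encode (x : DiscInstance) : threshold x.encode = x.threshold :=
  ratOfCode_ratCode _

theorem tableCode_eq_rebuildTable {n m : ℕ} {t : Fin n → Fin m → Fin n → ℚ}
    {l : List (List (List (ℤ × ℕ)))} (h : ∀ q a q', t q a q' = tableAt l q a q') :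
    tableCode t = rebuildTable n m l :=
  List.ofFn_eq_map_range fun q => List.ofFn_eq_map_range fun a => List.ofFn_eq_map_range
    fun q' => congrArg ratCode (h q a q')

/-- Decoding is total, with defaults and unreduced fractions allowed. The equation `rebuild c = c`
excludes wrong dimensions and unreduced fractions, and the remaining clauses are the constraints on
an instance. -/
theorem valid_iff (c : DiscCode) : Valid c ↔ ∃ x : DiscInstance, x.encode = c := by
  constructor
  · rintro ⟨hc, ⟨hi, hi'⟩, ht, hd0, hd1⟩
    refine ⟨⟨c.1.1, c.1.2, fun q => initAt c q, ⟨fun q => hi q q.2, ?_⟩,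
      fun q a q' => transAt c q a q', fun q a => ⟨fun q' => (ht q q.2 a a.2).1 q' q'.2, ?_⟩,
      fun q a q' => weightAt c q a q', discount c, hd0, hd1, threshold c⟩, ?_⟩
    · rw [← hi', Finset.sum_range]
    · rw [← (ht q q.2 a a.2).2, Finset.sum_range]
    · refine Eq.trans ?_ hc
      refine Prod.ext rfl (Prod.ext (Prod.ext ?_ (Prod.ext ?_ ?_)) rfl)
      · exact List.ofFn_eq_map_range fun q => rfl
      · exact tableCode_eq_rebuildTable fun _ _ _ => rfl
      · exact tableCode_eq_rebuildTable fun _ _ _ => rfl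
  · rintro ⟨x, rfl⟩
    refine ⟨?_, ⟨?_, ?_⟩, ?_, ?_, ?_⟩
    · refine Prod.ext rfl (Prod.ext (Prod.ext ?_ (Prod.ext ?_ ?_)) (Prod.ext ?_ ?_))
      · exact (List.ofFn_eq_map_range fun q : Fin x.numStates =>
          congrArg ratCode (initAt_encode x q).symm).symm
      · exact (tableCode_eq_rebuildTable fun q a q' => (tableAt_tableCode x.trans q a q').symm).symm
      · exact (tableCode_eq_rebuildTable fun q a q' => (tableAt_tableCode x.weight q a q').symm).symm
      · exact congrArg ratCode (discount_encode x)
      · exact congrArg ratCode (threshold_encode x)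
    · intro q hq
      rw [initAt_encode x ⟨q, hq⟩]
      exact x.init_mem.1 _
    · rw [← x.init_mem.2]
      exact (Finset.sum_range _).trans (Finset.sum_congr rfl fun q _ => initAt_encode x q)
    · refine fun q hq a ha => ⟨fun q' hq' => ?_, ?_⟩
      · rw [transAt_encode x ⟨q, hq⟩ ⟨a, ha⟩ ⟨q', hq'⟩]
        exact (x.trans_mem _ _).1 _
      · rw [← (x.trans_mem ⟨q, hq⟩ ⟨a, ha⟩).2]
        exact (Finset.sum_range _).trans
          (Finset.sum_congr rfl fun q' _ => transAt_encode x ⟨q, hq⟩ ⟨a, ha⟩ q')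
    · simpa using x.discount_pos
    · simpa using x.discount_lt_one

/-! ### Primitive recursive checks of certificates on codes -/

/-- The right-hand side of the Bellman equation. -/
def bellman (c : DiscCode) (U : List ℚ) (q a q' : ℕ) : ℚ :=
  weightAt c q a q' + discount c * U.getD q' 0

/-- The check of a certificate for nonemptiness under the positive semantics. -/
def PosCertificate (c : DiscCode) (U : List ℚ) : Prop :=
  (∀ q < c.1.1, ∃ a < c.1.2, ∃ q' < c.1.1, 0 < transAt c q a q' ∧
    U.getD q 0 ≤ bellman c U q a q') ∧
    ∃ q < c.1.1, 0 < initAt c q ∧ threshold c ≤ U.getD q 0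

/-- The check of a certificate for emptiness under the positive semantics. -/
def PosRefutation (c : DiscCode) (U : List ℚ) : Prop :=
  (∀ q < c.1.1, ∀ a < c.1.2, ∀ q' < c.1.1, 0 < transAt c q a q' →
    bellman c U q a q' ≤ U.getD q 0) ∧
    ∀ q < c.1.1, 0 < initAt c q → U.getD q 0 < threshold c

/-- The check of a certificate for universality under the almost-sure semantics. -/
def AsCertificate (c : DiscCode) (U : List ℚ) : Prop :=
  (∀ q < c.1.1, ∀ a < c.1.2, ∀ q' < c.1.1, 0 < transAt c q a q' →
    U.getD q 0 ≤ bellman c U q a q') ∧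
    ∀ q < c.1.1, 0 < initAt c q → threshold c ≤ U.getD q 0

/-- The check of a certificate for non-universality under the almost-sure semantics. -/
def AsRefutation (c : DiscCode) (U : List ℚ) : Prop :=
  (∀ q < c.1.1, ∃ a < c.1.2, ∃ q' < c.1.1, 0 < transAt c q a q' ∧
    bellman c U q a q' ≤ U.getD q 0) ∧
    ∃ q < c.1.1, 0 < initAt c q ∧ U.getD q 0 < threshold c

section Primrec

theorem primrec_potential :
    Primrec fun p : (((DiscCode × List ℚ) × ℕ) × ℕ) × ℕ => p.1.1.1.2.getD p.1.1.2 0 :=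
  (Primrec.list_getD 0).comp
    (Primrec.snd.comp (Primrec.fst.comp (Primrec.fst.comp .fst)))
    (Primrec.snd.comp (Primrec.fst.comp .fst))

theorem primrec_bellman :
    Primrec fun p : (((DiscCode × List ℚ) × ℕ) × ℕ) × ℕ =>
      bellman p.1.1.1.1 p.1.1.1.2 p.1.1.2 p.1.2 p.2 :=
  have hc : Primrec fun p : (((DiscCode × List ℚ) × ℕ) × ℕ) × ℕ => p.1.1.1.1 :=
    Primrec.fst.comp (Primrec.fst.comp (Primrec.fst.comp .fst))
  Primrec.rat_add.comp
    (primrec_weightAt hc (Primrec.snd.comp (Primrec.fst.comp .fst)) (Primrec.snd.comp .fst) .snd)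
    (Primrec.rat_mul.comp (primrec_discount hc) ((Primrec.list_getD 0).comp
      (Primrec.snd.comp (Primrec.fst.comp (Primrec.fst.comp .fst))) .snd))

theorem primrecPred_edge :
    PrimrecPred fun p : (((DiscCode × List ℚ) × ℕ) × ℕ) × ℕ =>
      0 < transAt p.1.1.1.1 p.1.1.2 p.1.2 p.2 :=
  PrimrecRel.rat_lt.comp (.const 0) (primrec_transAt
    (Primrec.fst.comp (Primrec.fst.comp (Primrec.fst.comp .fst)))
    (Primrec.snd.comp (Primrec.fst.comp .fst)) (Primrec.snd.comp .fst) .snd)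

variable {R : DiscCode × List ℚ → ℕ → ℕ → ℕ → Prop}

/-- Variables are packed in left-nested pairs, so that each bounded quantifier binds the last
component. -/
theorem primrecPred_forall_exists_exists
    (hR : PrimrecPred fun p : (((DiscCode × List ℚ) × ℕ) × ℕ) × ℕ => R p.1.1.1 p.1.1.2 p.1.2 p.2) :
    PrimrecPred fun p : DiscCode × List ℚ =>
      ∀ q < p.1.1.1, ∃ a < p.1.1.2, ∃ q' < p.1.1.1, R p q a q' :=
  .forall_lt_comp (primrec_numStates .fst) (PrimrecPred.exists_lt_comp
    (primrec_numLetters (Primrec.fst.comp .fst)) (PrimrecPred.exists_lt_comp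
      (primrec_numStates (Primrec.fst.comp (Primrec.fst.comp .fst))) hR))

theorem primrecPred_forall_forall_forall
    (hR : PrimrecPred fun p : (((DiscCode × List ℚ) × ℕ) × ℕ) × ℕ => R p.1.1.1 p.1.1.2 p.1.2 p.2) :
    PrimrecPred fun p : DiscCode × List ℚ =>
      ∀ q < p.1.1.1, ∀ a < p.1.1.2, ∀ q' < p.1.1.1, R p q a q' :=
  .forall_lt_comp (primrec_numStates .fst) (PrimrecPred.forall_lt_comp
    (primrec_numLetters (Primrec.fst.comp .fst)) (PrimrecPred.forall_lt_comp
      (primrec_numStates (Primrec.fst.comp (Primrec.fst.comp .fst))) hR))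

theorem primrecPred_init_pos :
    PrimrecPred fun p : (DiscCode × List ℚ) × ℕ => 0 < initAt p.1.1 p.2 :=
  PrimrecRel.rat_lt.comp (.const 0) (primrec_initAt (Primrec.fst.comp .fst) .snd)

theorem primrecPred_threshold_le :
    PrimrecPred fun p : (DiscCode × List ℚ) × ℕ => threshold p.1.1 ≤ p.1.2.getD p.2 0 :=
  PrimrecRel.rat_le.comp (primrec_threshold (Primrec.fst.comp .fst))
    ((Primrec.list_getD 0).comp (Primrec.snd.comp .fst) .snd)

theorem primrecPred_lt_threshold :
    PrimrecPred fun p : (DiscCode × List ℚ) × ℕ => p.1.2.getD p.2 0 < threshold p.1.1 :=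
  PrimrecRel.rat_lt.comp ((Primrec.list_getD 0).comp (Primrec.snd.comp .fst) .snd)
    (primrec_threshold (Primrec.fst.comp .fst))

theorem primrecRel_posCertificate : PrimrecRel PosCertificate :=
  PrimrecPred.and
    (primrecPred_forall_exists_exists
      (primrecPred_edge.and (PrimrecRel.rat_le.comp primrec_potential primrec_bellman)))
    (.exists_lt_comp (primrec_numStates .fst) (primrecPred_init_pos.and primrecPred_threshold_le))

theorem primrecRel_posRefutation : PrimrecRel PosRefutation :=
  PrimrecPred.and
    (primrecPred_forall_forall_forall
      (primrecPred_edge.imp (PrimrecRel.rat_le.comp primrec_bellman primrec_potential)))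
    (.forall_lt_comp (primrec_numStates .fst) (primrecPred_init_pos.imp primrecPred_lt_threshold))

theorem primrecRel_asCertificate : PrimrecRel AsCertificate :=
  PrimrecPred.and
    (primrecPred_forall_forall_forall
      (primrecPred_edge.imp (PrimrecRel.rat_le.comp primrec_potential primrec_bellman)))
    (.forall_lt_comp (primrec_numStates .fst) (primrecPred_init_pos.imp primrecPred_threshold_le))

theorem primrecRel_asRefutation : PrimrecRel AsRefutation :=
  PrimrecPred.and
    (primrecPred_forall_exists_exists
      (primrecPred_edge.and (PrimrecRel.rat_le.comp primrec_bellman primrec_potential)))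
    (.exists_lt_comp (primrec_numStates .fst) (primrecPred_init_pos.and primrecPred_lt_threshold))

end Primrec

/-! ### Transfer of the checks from codes to instances -/

theorem forall_lt_iff_forall_fin {n : ℕ} {p : ℕ → Prop} : (∀ i < n, p i) ↔ ∀ i : Fin n, p i := by
  simp [Fin.forall_iff]

theorem exists_lt_iff_exists_fin {n : ℕ} {p : ℕ → Prop} : (∃ i < n, p i) ↔ ∃ i : Fin n, p i := by
  simp [Fin.exists_iff]

/-- A list as a function on the states. -/
def potential (n : ℕ) (U : List ℚ) (q : Fin n) : ℚ := U.getD q 0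

/-- Lists serve as certificates because their type does not depend on the number of states.
Surjectivity shows that no potential is lost. -/
theorem potential_surjective (n : ℕ) : Function.Surjective (potential n) := fun V =>
  ⟨List.ofFn V, funext fun q => List.getD_ofFn V q 0⟩

variable (x : DiscInstance) (U : List ℚ)

theorem posCertificate_encode :
    PosCertificate x.encode U ↔ x.PosCertificate (potential _ U) := by
  simp only [PosCertificate, forall_lt_iff_forall_fin, exists_lt_iff_exists_fin, bellman,
    show x.encode.1.1 = x.numStates from rfl, show x.encode.1.2 = x.numLetters from rfl,
    initAt_encode, transAt_encode, weightAt_encode, discount_encode, threshold_encode]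
  rfl

theorem posRefutation_encode :
    PosRefutation x.encode U ↔ x.PosRefutation (potential _ U) := by
  simp only [PosRefutation, forall_lt_iff_forall_fin, bellman,
    show x.encode.1.1 = x.numStates from rfl, show x.encode.1.2 = x.numLetters from rfl,
    initAt_encode, transAt_encode, weightAt_encode, discount_encode, threshold_encode]
  rfl

theorem asCertificate_encode :
    AsCertificate x.encode U ↔ x.AsCertificate (potential _ U) := by
  simp only [AsCertificate, forall_lt_iff_forall_fin, bellman,
    show x.encode.1.1 = x.numStates from rfl, show x.encode.1.2 = x.numLetters from rfl,
    initAt_encode, transAt_encode, weightAt_encode, discount_encode, threshold_encode]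
  rfl

theorem asRefutation_encode :
    AsRefutation x.encode U ↔ x.AsRefutation (potential _ U) := by
  simp only [AsRefutation, forall_lt_iff_forall_fin, exists_lt_iff_exists_fin, bellman,
    show x.encode.1.1 = x.numStates from rfl, show x.encode.1.2 = x.numLetters from rfl,
    initAt_encode, transAt_encode, weightAt_encode, discount_encode, threshold_encode]
  rfl

end DiscCode

theorem DiscInstance.decidableProblem_of_certificates {P : DiscInstance → Prop}
    {R R' : DiscCode → List ℚ → Prop} (hR : PrimrecRel R) (hR' : PrimrecRel R')
    (h : ∀ x, P x ↔ ∃ U, R x.encode U) (h' : ∀ x, ¬ P x ↔ ∃ U, R' x.encode U) :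
    DecidableProblem P := by
  have hv : PrimrecRel fun (c : DiscCode) (_ : List ℚ) => DiscCode.Valid c :=
    DiscCode.primrecPred_valid.comp .fst
  have key : ∀ x : DiscInstance, (∃ y : DiscInstance, y.encode = x.encode ∧ P y) ↔ P x := fun x =>
    ⟨fun ⟨y, hy, hP⟩ => encode_injective hy ▸ hP, fun hP => ⟨x, rfl, hP⟩⟩
  refine computablePred_of_certificates
    -- A code of no instance is a negative input, and any list refutes it.
    (R := fun c U => DiscCode.Valid c ∧ R c U) (R' := fun c U => ¬ DiscCode.Valid c ∨ R' c U)
    (PrimrecPred.and hv hR) (PrimrecPred.or (PrimrecPred.not hv) hR')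
    (fun c => ?_) fun c => ?_
  · by_cases hc : DiscCode.Valid c
    · obtain ⟨x, rfl⟩ := (DiscCode.valid_iff c).1 hc
      simp only [key, hc, true_and]
      exact h x
    · simp only [hc, false_and, exists_false, iff_false]
      rintro ⟨x, hx, -⟩
      exact hc ((DiscCode.valid_iff c).2 ⟨x, hx⟩)
  · by_cases hc : DiscCode.Valid c
    · obtain ⟨x, rfl⟩ := (DiscCode.valid_iff c).1 hc
      simp only [key, hc, not_true_eq_false, false_or]
      exact h' x
    · simp only [hc, not_false_eq_true, true_or, exists_const, iff_true]
      rintro ⟨x, hx, -⟩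
      exact hc ((DiscCode.valid_iff c).2 ⟨x, hx⟩)

theorem mainTheorem11 :
    DiscInstance.DecidableProblem DiscInstance.PosNonempty ∧
      DiscInstance.DecidableProblem DiscInstance.AsUniversal := by
  refine ⟨DiscInstance.decidableProblem_of_certificates DiscCode.primrecRel_posCertificate
      DiscCode.primrecRel_posRefutation (fun x => ?_) fun x => ?_,
    DiscInstance.decidableProblem_of_certificates DiscCode.primrecRel_asCertificate
      DiscCode.primrecRel_asRefutation (fun x => ?_) fun x => ?_⟩
  · simp only [DiscInstance.posNonempty_iff, DiscCode.posCertificate_encode,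
      (DiscCode.potential_surjective _).exists]
  · simp only [DiscInstance.not_posNonempty_iff, DiscCode.posRefutation_encode,
      (DiscCode.potential_surjective _).exists]
  · simp only [DiscInstance.asUniversal_iff, DiscCode.asCertificate_encode,
      (DiscCode.potential_surjective _).exists]
  · simp only [DiscInstance.not_asUniversal_iff, DiscCode.asRefutation_encode,
      (DiscCode.potential_surjective _).exists]
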